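/- Let $p\in[1,2)$, $\gamma>1$, $\lambda_0>0$, let $E=\ell^p(\mathbb N)$ be the real sequence space with canonical basis $(e_n)_{n\ge 0}$, and put $\lambda_n:=\lambda_0/(n+1)^{\gamma/p}$ for $n\ge 0$. Let $T$ be the bounded weighted backward shift on $E$ determined by $$Te_0=0,\qquad Te_{n+1}=\Big(1+\frac1{n+1}\Big)^{\gamma/p}e_n,\quad n\ge 0,$$ and let $\mu$ be the compound Poisson probability measure on $E$ with Lévy measure $\lambda(dz)=\sum_{n\ge 0}\delta_{\lambda_ne_n}(dz)$, i.e. the probability measure with characteristic functional $$\int_E e^{i\langle z,x^*\rangle}\mu(dz)=\exp\Big(i\langle\hat x,x^*\rangle+\int_E\big(e^{i\langle z,x^*\rangle}-1-i\kappa(z)\langle z,x^*\rangle\big)\lambda(dz)\Big),\qquad x^*\in E^*,$$ where $\hat x=\sum_{n\ge 0}\lambda_ne_n$ and $\kappa(z)=\mathbf 1_{\{\|z\|\le\max_n\lambda_n\}}$. (Both $T$ and $\mu$ exist and are unique.) For $x^*,y^*\in E^*$ let $$C_\mu^=(x^*,y^*)=\log\int_E e^{i\langle z,x^*-y^*\rangle}\mu(dz)-\log\int_E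 e^{i\langle z,x^*\rangle}\mu(dz)-\log\int_E e^{-i\langle z,y^*\rangle}\mu(dz)$$ be the codifference, where $\log\int_E e^{i\langle z,x^*\rangle}\mu(dz)$ denotes the distinguished logarithm, i.e. the unique continuous function of $x^*\in E^*$ that vanishes at $0$ and whose exponential is the characteristic functional (it exists). Then $\mu$ is invariant under $T$, and $T$ is (strongly) mixing with respect to $\mu$: $\mu(A\cap T^{-n}B)\to\mu(A)\mu(B)$ as $n\to\infty$ for all Borel sets $A,B\subset E$. Moreover, for all $n\ge 1$, $$\sup_{x^*,y^*\in E^*\setminus\{0\}}\frac{|C_\mu^=(x^*,T^{*n}y^*)|}{\|x^*\|^{p/2}\|y^*\|^{p/2}}\le \begin{cases} 2^{4-p}\lambda_0^p\,\mathrm B\big(1-\frac\gamma2,\gamma-1\big)\,n^{-(\gamma-1)}, & 1<\gamma<2,\\[1ex] 2^{4-p}\lambda_0^p\,\mathrm B\big(\frac\varepsilon2,1-\varepsilon\big)\,n^{-(1-\varepsilon)}\quad\text{for every }\varepsilon\in(0,1), & \gamma\ge 2, \end{cases}$$ where $\mathrm B$ is the beta function. -/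

import Mathlib

open MeasureTheory ProbabilityTheory Filter Topology
open scoped ENNReal

noncomputable section

/-- The real sequence space `ℓ^p(ℕ)`, for a real exponent `p`. -/
abbrev EllP (p : ℝ) : Type := lp (fun _ : ℕ => ℝ) (ENNReal.ofReal p)

instance fact_one_le_ofReal (p : ℝ) [hp : Fact (1 ≤ p)] : Fact (1 ≤ ENNReal.ofReal p) :=
  ⟨ENNReal.one_le_ofReal.mpr hp.out⟩

/-- The canonical basis vector `e_n` of `ℓ^p(ℕ)`. -/
def basisVec (p : ℝ) (n : ℕ) : EllP p := lp.single (ENNReal.ofReal p) n (1 : ℝ)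

section Banach

variable {E : Type*} [NormedAddCommGroup E] [NormedSpace ℝ E] [MeasurableSpace E]

/-- A Lévy measure on a real Banach space: no mass at the origin, and `min(1, ⟨z, x⟩²)` is
integrable for every continuous linear functional `x`. -/
structure IsLevyMeasure (ν : Measure E) : Prop where
  measure_zero : ν {0} = 0
  lintegral_lt_top : ∀ x : StrongDual ℝ E, ∫⁻ z, ENNReal.ofReal (min 1 ((x z) ^ 2)) ∂ν < ∞

/-- A truncation function: bounded, measurable, tending to `1` at the origin and
`O(1/‖z‖)` at infinity. -/
structure IsTruncationFunction (κ : E → ℝ) : Prop where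
  measurable : Measurable κ
  bounded : ∃ C : ℝ, ∀ z, |κ z| ≤ C
  tendsto_one : Tendsto κ (𝓝 0) (𝓝 1)
  isBigO : κ =O[Bornology.cobounded E] fun z => 1 / ‖z‖

/-- The Lévy–Khintchine integrand `e^{i⟨z,x⟩} - 1 - i κ(z) ⟨z,x⟩`. -/
def levyKhintchineIntegrand (κ : E → ℝ) (x : StrongDual ℝ E) (z : E) : ℂ :=
  Complex.exp (Complex.I * (x z : ℂ)) - 1 - Complex.I * (κ z : ℂ) * (x z : ℂ)

/-- `μ` is a probability measure whose characteristic functional is of Lévy–Khintchine form with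
covariance operator `0`, drift vector `a`, truncation function `κ` and Lévy measure `ν`:
`∫ e^{i⟨z,x⟩} μ(dz) = exp (i⟨a,x⟩ + ∫ (e^{i⟨z,x⟩} - 1 - iκ(z)⟨z,x⟩) ν(dz))`
for all continuous linear functionals `x`. -/
structure HasLevyKhintchine (μ : Measure E) (a : E) (κ : E → ℝ) (ν : Measure E) : Prop where
  isProbabilityMeasure : IsProbabilityMeasure μ
  isLevyMeasure : IsLevyMeasure ν
  isTruncationFunction : IsTruncationFunction κ
  integrable : ∀ x : StrongDual ℝ E, Integrable (levyKhintchineIntegrand κ x) ν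
  charFunDual_eq : ∀ x : StrongDual ℝ E,
    charFunDual μ x =
      Complex.exp (Complex.I * (x a : ℂ) + ∫ z, levyKhintchineIntegrand κ x z ∂ν)

/-- `ψ` is the distinguished logarithm of the characteristic functional of `μ`: continuous on the
dual, zero at zero, with `exp ∘ ψ` the characteristic functional.  (As the dual is connected,
there is at most one such `ψ`.) -/
structure IsDistinguishedLog (μ : Measure E) (ψ : StrongDual ℝ E → ℂ) : Prop where
  continuous : Continuous ψ
  map_zero : ψ 0 = 0
  exp_eq : ∀ x : StrongDual ℝ E, Complex.exp (ψ x) = charFunDual μ x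

open Classical in
/-- The logarithm `log ∫ e^{i⟨z,x⟩} μ(dz)` of the characteristic functional (the distinguished
logarithm; the value `0` is used only if there is none). -/
def logCharFunctional (μ : Measure E) : StrongDual ℝ E → ℂ :=
  if h : ∃ ψ : StrongDual ℝ E → ℂ, IsDistinguishedLog μ ψ then h.choose else 0

/-- The codifference functional
`C(x,y) = log ∫ e^{i⟨z,x-y⟩} μ(dz) - log ∫ e^{i⟨z,x⟩} μ(dz) - log ∫ e^{-i⟨z,y⟩} μ(dz)`. -/
def codifference (μ : Measure E) (x y : StrongDual ℝ E) : ℂ :=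
  logCharFunctional μ (x - y) - logCharFunctional μ x - logCharFunctional μ (-y)

/-- Strong mixing: `μ (A ∩ T⁻ⁿ B) → μ A * μ B` for all measurable sets `A`, `B`. -/
def IsStronglyMixing (T : E → E) (μ : Measure E) : Prop :=
  ∀ A B : Set E, MeasurableSet A → MeasurableSet B →
    Tendsto (fun n : ℕ => μ (A ∩ T^[n] ⁻¹' B)) atTop (𝓝 (μ A * μ B))

end Banach

/-- The sequence `λ_n = λ₀ / (n+1)^{γ/p}`. -/
def lambdaSeq (p γ lam0 : ℝ) (n : ℕ) : ℝ := lam0 / ((n : ℝ) + 1) ^ (γ / p)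

section Example

variable (p : ℝ) [Fact (1 ≤ p)]

/-- `T` is the bounded weighted backward shift with `T e₀ = 0` and
`T e_{n+1} = (1 + 1/(n+1))^{γ/p} e_n` for `n ≥ 0`. -/
structure IsWeightedBackwardShift (γ : ℝ) (T : EllP p →L[ℝ] EllP p) : Prop where
  map_zero : T (basisVec p 0) = 0
  map_succ : ∀ n : ℕ,
    T (basisVec p (n + 1)) = ((1 + 1 / ((n : ℝ) + 1)) ^ (γ / p)) • basisVec p n

/-- The measure `∑ₙ δ_{l_n e_n}` on `ℓ^p(ℕ)`. -/
def poissonLevyMeasure [MeasurableSpace (EllP p)] (l : ℕ → ℝ) : Measure (EllP p) :=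
  Measure.sum fun n => Measure.dirac (l n • basisVec p n)

open Classical in
/-- The truncation function `z ↦ 1_{‖z‖ ≤ max_n l_n}`. -/
def ballTruncation (l : ℕ → ℝ) (z : EllP p) : ℝ :=
  if ‖z‖ ≤ ⨆ n, l n then 1 else 0

/-- `μ` is the compound Poisson measure on `ℓ^p(ℕ)` attached to `l`: covariance `0`, drift
`∑ₙ l_n e_n`, truncation `1_{‖z‖ ≤ max_n l_n}` and Lévy measure `∑ₙ δ_{l_n e_n}`. -/
def IsCompoundPoisson [MeasurableSpace (EllP p)] (l : ℕ → ℝ) (μ : Measure (EllP p)) : Prop :=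
  HasLevyKhintchine μ (∑' n, l n • basisVec p n) (ballTruncation p l) (poissonLevyMeasure p l)

end Example

end

/-! Write `l n` for `λ_n`. Every atom `l n • e_n` lies where the truncation equals 1, so the drift
cancels the compensator and the characteristic exponent is `∑ₙ (e^{i⟨l n e_n, x⟩} - 1)`, the one of
`∑ₙ N_n l n e_n` with `N_n` independent Poisson(1). This series converges almost surely because `∑
|l n|^p E[N_n^p]` is finite, which gives `μ`; its characteristic functional gives uniqueness.

The weights of `T` are the ratios `l n / l (n+1)`, so `T` carries each atom to the preceding one and
kills the first. Reindexing the exponent gives invariance. Moreover `T ^ n` depends only on the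
coordinates from `n` on, hence is independent of the first `n` coordinates; since truncations
converge to the identity, mixing follows (`isStronglyMixing_of_indepFun`).

For the rate, termwise factorisation makes the codifference `∑ₖ (e^{i⟨l k e_k, x⟩} - 1)(e^{-i⟨l k
e_k, y⟩} - 1)` (`hasSum_codifference`). Replacing `y` by its image under the adjoint of `T ^ n`
shifts the second factor by `n`. With `|e^{it} - 1| ≤ 2^{1-p/2} |t|^{p/2}` what remains is `∑
(j+1)^{-γ/2} (j+n+1)^{-γ/2}`, compared with a beta integral in `sum_rpow_mul_rpow_le_beta`. For `γ ≥
2` the exponent is first lowered to `2 - ε`. -/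

open MeasureTheory ProbabilityTheory Filter Topology
open scoped ENNReal

noncomputable section

/-! ### Coordinates, separability and absolute pairings in `ℓ^p` -/

section Basics

variable {p : ℝ} [Fact (1 ≤ p)]

lemma toReal_ofReal_of_one_le (p : ℝ) [hp : Fact (1 ≤ p)] : (ENNReal.ofReal p).toReal = p :=
  ENNReal.toReal_ofReal (zero_le_one.trans hp.out)

lemma EllP.pos_exponent (p : ℝ) [hp : Fact (1 ≤ p)] : 0 < p := zero_lt_one.trans_le hp.out

lemma norm_basisVec (n : ℕ) : ‖basisVec p n‖ = 1 := by
  rw [basisVec, lp.norm_single (zero_lt_one.trans_le Fact.out)]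
  exact norm_one

lemma EllP.hasSum_smul_basisVec (z : EllP p) : HasSum (fun n => z n • basisVec p n) z := by
  convert lp.hasSum_single ENNReal.ofReal_ne_top z using 2 with n
  rw [basisVec, ← lp.single_smul, smul_eq_mul, mul_one]

lemma EllP.clm_ext {F : Type*} [NormedAddCommGroup F] [NormedSpace ℝ F] {S T : EllP p →L[ℝ] F}
    (h : ∀ n, S (basisVec p n) = T (basisVec p n)) : S = T := by
  ext z
  refine ((EllP.hasSum_smul_basisVec z).mapL S).unique ?_
  convert (EllP.hasSum_smul_basisVec z).mapL T using 2 with n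
  simp [h]

/-- Finite combinations of basis vectors are dense. Separability is what lets characteristic
functionals determine Borel measures and makes sums of measurable maps measurable. -/
instance EllP.secondCountableTopology : SecondCountableTopology (EllP p) := by
  have hs : TopologicalSpace.IsSeparable (Set.univ : Set (EllP p)) := by
    refine ((((Set.countable_range (basisVec p)).isSeparable.span (R := ℝ)).closure)).mono
      fun z _ => ?_
    · refine mem_closure_of_tendsto (EllP.hasSum_smul_basisVec z) (Eventually.of_forall fun s => ?_)
      exact Submodule.sum_mem _ fun n _ =>
        Submodule.smul_mem _ _ (Submodule.subset_span ⟨n, rfl⟩)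
  have : TopologicalSpace.SeparableSpace (EllP p) :=
    TopologicalSpace.isSeparable_univ_iff.mp hs
  exact UniformSpace.secondCountable_of_separable _

lemma EllP.exists_of_summable {l : ℕ → ℝ} (h : Summable fun n => |l n| ^ p) :
    ∃ v : EllP p, (∀ n, v n = l n) ∧ ‖v‖ = (∑' n, |l n| ^ p) ^ (1 / p) := by
  have hm : Memℓp (E := fun _ : ℕ => ℝ) l (ENNReal.ofReal p) :=
    memℓp_gen (by simpa only [toReal_ofReal_of_one_le, Real.norm_eq_abs] using h)
  refine ⟨⟨l, hm⟩, fun n => rfl, ?_⟩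
  rw [lp.norm_eq_tsum_rpow (by rw [toReal_ofReal_of_one_le]; exact EllP.pos_exponent p),
    toReal_ofReal_of_one_le]
  rfl

lemma EllP.hasSum_of_summable {l : ℕ → ℝ} (h : Summable fun n => |l n| ^ p) :
    HasSum (fun n => l n • basisVec p n) (∑' n, l n • basisVec p n) := by
  obtain ⟨v, hv, -⟩ := EllP.exists_of_summable h
  have := EllP.hasSum_smul_basisVec v
  simp only [hv] at this
  exact this.summable.hasSum

/-- The pairing of a `p`-summable sequence with a functional converges absolutely, with a bound
by the norm of the functional. -/
lemma EllP.summable_abs_apply_and_tsum_le {l : ℕ → ℝ} (h : Summable fun n => |l n| ^ p)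
    (x : StrongDual ℝ (EllP p)) :
    Summable (fun n => |x (l n • basisVec p n)|) ∧
      ∑' n, |x (l n • basisVec p n)| ≤ (∑' n, |l n| ^ p) ^ (1 / p) * ‖x‖ := by
  -- Flipping signs of `l` keeps the `ℓ^p` norm and makes every term of the pairing nonnegative, so
  -- the absolute sum is the value of `x` at one vector.
  set s : ℕ → ℝ := fun n => if 0 ≤ x (l n • basisVec p n) then l n else - l n with hs
  have habs : ∀ n, |s n| = |l n| := fun n => by
    simp only [hs]; split_ifs <;> simp
  have hx : ∀ n, x (s n • basisVec p n) = |x (l n • basisVec p n)| := fun n => by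
    simp only [hs]
    split_ifs with h0
    · rw [abs_of_nonneg h0]
    · rw [neg_smul, map_neg, abs_of_neg (not_le.mp h0)]
  obtain ⟨v, hv, hn⟩ := EllP.exists_of_summable (p := p) (l := s) (by simpa only [habs] using h)
  have hsum := (EllP.hasSum_smul_basisVec v).mapL x
  simp only [hv, hx] at hsum
  refine ⟨hsum.summable, ?_⟩
  rw [hsum.tsum_eq]
  calc x v ≤ ‖x v‖ := Real.le_norm_self _
    _ ≤ ‖x‖ * ‖v‖ := x.le_opNorm v
    _ = _ := by rw [hn, mul_comm]; simp only [habs]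

/-- Ensures that `⨆ n, l n` in the truncation is a genuine supremum and not the default value 0. -/
lemma EllP.bddAbove_of_summable {l : ℕ → ℝ} (h : Summable fun n => |l n| ^ p) :
    BddAbove (Set.range l) := by
  obtain ⟨v, hv, -⟩ := EllP.exists_of_summable h
  refine ⟨‖v‖, ?_⟩
  rintro _ ⟨n, rfl⟩
  rw [← hv n]
  exact (Real.le_norm_self _).trans
    (lp.norm_apply_le_norm (zero_lt_one.trans_le Fact.out).ne' v n)

end Basics

/-! ### The characteristic exponent and the Lévy–Khintchine form -/

section Exponent

variable {p : ℝ} [Fact (1 ≤ p)]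

/-- The characteristic exponent `∑ₙ (e^{i ⟨lₙ eₙ, x⟩} - 1)`. -/
def poissonExponent (l : ℕ → ℝ) (x : StrongDual ℝ (EllP p)) : ℂ :=
  ∑' n, (Complex.exp (Complex.I * (x (l n • basisVec p n) : ℝ)) - 1)

lemma norm_cexp_I_mul_sub_cexp_I_mul_le (a b : ℝ) :
    ‖Complex.exp (Complex.I * a) - Complex.exp (Complex.I * b)‖ ≤ |a - b| := by
  have : Complex.exp (Complex.I * a) - Complex.exp (Complex.I * b) =
      Complex.exp (Complex.I * b) * (Complex.exp (Complex.I * (a - b : ℝ)) - 1) := by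
    rw [mul_sub, ← Complex.exp_add]
    push_cast
    ring_nf
  rw [this, norm_mul, Complex.norm_exp_I_mul_ofReal, one_mul]
  exact Real.norm_exp_I_mul_ofReal_sub_one_le

variable {l : ℕ → ℝ}

lemma summable_poissonExponent (h : Summable fun n => |l n| ^ p) (x : StrongDual ℝ (EllP p)) :
    Summable fun n => Complex.exp (Complex.I * (x (l n • basisVec p n) : ℝ)) - 1 :=
  Summable.of_norm_bounded (EllP.summable_abs_apply_and_tsum_le h x).1 fun _ =>
    Real.norm_exp_I_mul_ofReal_sub_one_le

lemma continuous_poissonExponent (h : Summable fun n => |l n| ^ p) :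
    Continuous (poissonExponent (p := p) l) := by
  refine (LipschitzWith.of_dist_le_mul (K := ((∑' n, |l n| ^ p) ^ (1 / p)).toNNReal)
    fun x y => ?_).continuous
  rw [dist_eq_norm, dist_eq_norm, poissonExponent, poissonExponent,
    ← (summable_poissonExponent h x).tsum_sub (summable_poissonExponent h y)]
  obtain ⟨h1, h2⟩ := EllP.summable_abs_apply_and_tsum_le h (x - y)
  rw [Real.coe_toNNReal _ (by positivity)]
  refine (tsum_of_norm_bounded h1.hasSum fun n => ?_).trans h2
  rw [sub_sub_sub_cancel_right]
  exact norm_cexp_I_mul_sub_cexp_I_mul_le _ _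

lemma poissonExponent_zero : poissonExponent (p := p) l 0 = 0 := by
  simp [poissonExponent]

lemma isLevyMeasure_poissonLevyMeasure [MeasurableSpace (EllP p)] [BorelSpace (EllP p)]
    (h : Summable fun n => |l n| ^ p) (hpos : ∀ n, 0 < l n) :
    IsLevyMeasure (poissonLevyMeasure p l) where
  measure_zero := by
    rw [poissonLevyMeasure, Measure.sum_apply _ (measurableSet_singleton _)]
    refine ENNReal.tsum_eq_zero.mpr fun n => ?_
    rw [Measure.dirac_apply' _ (measurableSet_singleton _), Set.indicator_of_notMem]
    intro h0
    have h1 := congrArg norm (Set.mem_singleton_iff.mp h0)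
    rw [norm_smul, norm_basisVec, norm_zero, mul_one, norm_eq_zero] at h1
    exact (hpos n).ne' h1
  lintegral_lt_top x := by
    rw [poissonLevyMeasure, lintegral_sum_measure]
    refine lt_of_le_of_lt (ENNReal.tsum_le_tsum fun n => ?_)
      (EllP.summable_abs_apply_and_tsum_le h x).1.tsum_ofReal_lt_top
    rw [lintegral_dirac]
    refine ENNReal.ofReal_le_ofReal ?_
    set t := x (l n • basisVec p n)
    rcases le_total |t| 1 with ht | ht
    · refine (min_le_right _ _).trans ?_
      rw [← sq_abs]
      nlinarith [abs_nonneg t]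
    · exact (min_le_left _ _).trans ht

lemma isTruncationFunction_ballTruncation [MeasurableSpace (EllP p)] [BorelSpace (EllP p)]
    (h : Summable fun n => |l n| ^ p) (hpos : ∀ n, 0 < l n) :
    IsTruncationFunction (ballTruncation p l) where
  measurable := by
    unfold ballTruncation
    exact Measurable.ite (measurableSet_le measurable_norm measurable_const)
      measurable_const measurable_const
  bounded := ⟨1, fun z => by unfold ballTruncation; split_ifs <;> simp⟩
  tendsto_one := by
    refine tendsto_const_nhds.congr' ?_
    have hS : 0 < ⨆ n, l n := (hpos 0).trans_le (le_ciSup (EllP.bddAbove_of_summable h) 0)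
    filter_upwards [Metric.closedBall_mem_nhds (0 : EllP p) hS] with z hz
    rw [ballTruncation, if_pos (by simpa using hz)]
  isBigO := by
    refine Asymptotics.IsBigO.of_bound 1 ?_
    filter_upwards [(tendsto_norm_cobounded_atTop (E := EllP p)).eventually_gt_atTop (⨆ n, l n)]
      with z hz
    rw [ballTruncation, if_neg (not_le.mpr hz), norm_zero]
    positivity

lemma levyKhintchineIntegrand_ballTruncation
    (h : Summable fun n => |l n| ^ p) (hpos : ∀ n, 0 < l n) (x : StrongDual ℝ (EllP p)) (n : ℕ) :
    levyKhintchineIntegrand (ballTruncation p l) x (l n • basisVec p n) =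
      (Complex.exp (Complex.I * (x (l n • basisVec p n) : ℝ)) - 1) -
        Complex.I * (x (l n • basisVec p n) : ℝ) := by
  have : ballTruncation p l (l n • basisVec p n) = 1 := by
    rw [ballTruncation, if_pos]
    rw [norm_smul, norm_basisVec, mul_one, Real.norm_of_nonneg (hpos n).le]
    exact le_ciSup (EllP.bddAbove_of_summable h) n
  rw [levyKhintchineIntegrand, this]
  simp

lemma integrable_levyKhintchineIntegrand [MeasurableSpace (EllP p)] [BorelSpace (EllP p)]
    (h : Summable fun n => |l n| ^ p) (hpos : ∀ n, 0 < l n) (x : StrongDual ℝ (EllP p)) :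
    Integrable (levyKhintchineIntegrand (ballTruncation p l) x) (poissonLevyMeasure p l) := by
  refine integrable_sum_measure (fun n => integrable_dirac (by simp)) ?_
  have h1 := (EllP.summable_abs_apply_and_tsum_le h x).1
  refine Summable.of_nonneg_of_le (fun n => by positivity) (fun n => ?_) (h1.mul_left 2)
  rw [integral_dirac, levyKhintchineIntegrand_ballTruncation h hpos]
  refine (norm_sub_le _ _).trans ?_
  rw [two_mul]
  refine add_le_add Real.norm_exp_I_mul_ofReal_sub_one_le ?_
  simp

/-- The drift restores, atom by atom, exactly the linear term that the compensator subtracts. -/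
lemma levyKhintchine_exponent_eq [MeasurableSpace (EllP p)] [BorelSpace (EllP p)]
    (h : Summable fun n => |l n| ^ p) (hpos : ∀ n, 0 < l n) (x : StrongDual ℝ (EllP p)) :
    Complex.I * (x (∑' n, l n • basisVec p n) : ℝ) +
      ∫ z, levyKhintchineIntegrand (ballTruncation p l) x z ∂(poissonLevyMeasure p l) =
    poissonExponent l x := by
  have h1 := hasSum_integral_measure (integrable_levyKhintchineIntegrand h hpos x)
  simp only [integral_dirac, levyKhintchineIntegrand_ballTruncation h hpos] at h1
  have h2 := ((Complex.hasSum_ofReal.mpr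
    ((EllP.hasSum_of_summable h).mapL x)).mul_left Complex.I).add h1
  simp only [add_sub_cancel] at h2
  exact h2.tsum_eq.symm

lemma isCompoundPoisson_iff [MeasurableSpace (EllP p)] [BorelSpace (EllP p)]
    (h : Summable fun n => |l n| ^ p) (hpos : ∀ n, 0 < l n) {μ : Measure (EllP p)} :
    IsCompoundPoisson p l μ ↔
      IsProbabilityMeasure μ ∧ ∀ x, charFunDual μ x = Complex.exp (poissonExponent l x) := by
  constructor
  · intro hμ
    refine ⟨hμ.isProbabilityMeasure, fun x => ?_⟩
    rw [hμ.charFunDual_eq, levyKhintchine_exponent_eq h hpos]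
  · rintro ⟨h1, h2⟩
    exact ⟨h1, isLevyMeasure_poissonLevyMeasure h hpos, isTruncationFunction_ballTruncation h hpos,
      integrable_levyKhintchineIntegrand h hpos, fun x => by
        rw [h2, levyKhintchine_exponent_eq h hpos]⟩

lemma IsCompoundPoisson.unique [MeasurableSpace (EllP p)] [BorelSpace (EllP p)]
    {μ ν : Measure (EllP p)} (hμ : IsCompoundPoisson p l μ) (hν : IsCompoundPoisson p l ν) :
    μ = ν := by
  have := hμ.isProbabilityMeasure
  have := hν.isProbabilityMeasure
  refine Measure.ext_of_charFunDual (funext fun x => ?_)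
  rw [hμ.charFunDual_eq, hν.charFunDual_eq]

end Exponent

/-! ### Construction of `μ` from independent Poisson variables -/

section Existence

lemma integrable_rpow_poissonMeasure_one {q : ℝ} (hq : q ≤ 2) :
    Integrable (fun k : ℕ => (k : ℝ) ^ q) (poissonMeasure 1) := by
  rw [integrable_poissonMeasure_iff]
  refine Summable.of_nonneg_of_le (fun k => by positivity) (fun k => ?_)
    ((Real.summable_pow_div_factorial 4).mul_left (Real.exp (-1)))
  -- A crude bound that reduces the moment to the exponential series at 4; the case `k = 0` covers
  -- the convention `0 ^ 0 = 1`.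
  have h1 : (k : ℝ) ^ q ≤ 4 ^ k := by
    rcases Nat.eq_zero_or_pos k with rfl | hk
    · simpa using Real.zero_rpow_le_one q
    · calc (k : ℝ) ^ q ≤ (k : ℝ) ^ (2 : ℝ) :=
            Real.rpow_le_rpow_of_exponent_le (by exact_mod_cast hk) hq
        _ = (k : ℝ) ^ 2 := by norm_cast
        _ ≤ ((2 : ℝ) ^ k) ^ 2 := by
            gcongr
            exact_mod_cast Nat.lt_two_pow_self.le
        _ = 4 ^ k := by rw [← pow_mul, mul_comm, pow_mul]; norm_num
  rw [Real.norm_of_nonneg (by positivity)]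
  simp only [NNReal.coe_one, one_pow, mul_one]
  rw [mul_div_assoc', div_mul_eq_mul_div]
  gcongr

/-- Almost surely, `∑ |lₙ Nₙ|^q` converges for independent `Nₙ` with the Poisson law of
parameter one, if `∑ |lₙ|^q` converges and `q ≤ 2`. -/
lemma ae_summable_rpow_infinitePi_poissonMeasure {q : ℝ} (hq : q ≤ 2) {l : ℕ → ℝ}
    (h : Summable fun n => |l n| ^ q) :
    ∀ᵐ ω ∂(Measure.infinitePi fun _ : ℕ => poissonMeasure 1),
      Summable fun n => |l n * (ω n : ℝ)| ^ q := by
  set P := Measure.infinitePi fun _ : ℕ => poissonMeasure 1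
  have hint := integrable_rpow_poissonMeasure_one hq
  set c : ℝ≥0∞ := ∫⁻ k : ℕ, ENNReal.ofReal ((k : ℝ) ^ q) ∂(poissonMeasure 1) with hc
  have hcf : c ≠ ∞ := by
    have := hint.lintegral_lt_top
    exact this.ne
  have hmeas : ∀ n, Measurable fun ω : ℕ → ℕ => ENNReal.ofReal (|l n * (ω n : ℝ)| ^ q) := by
    intro n
    have h0 : Measurable fun k : ℕ => ENNReal.ofReal (|l n * (k : ℝ)| ^ q) :=
      measurable_from_top
    exact h0.comp (measurable_pi_apply n)
  have hval : ∀ n, ∫⁻ ω, ENNReal.ofReal (|l n * (ω n : ℝ)| ^ q) ∂P =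
      ENNReal.ofReal (|l n| ^ q) * c := by
    intro n
    have h1 : ∫⁻ ω, ENNReal.ofReal (|l n * (ω n : ℝ)| ^ q) ∂P =
        ∫⁻ k : ℕ, ENNReal.ofReal (|l n * (k : ℝ)| ^ q) ∂(poissonMeasure 1) :=
      (measurePreserving_eval_infinitePi (fun _ : ℕ => poissonMeasure 1) n).lintegral_comp
        (f := fun k : ℕ => ENNReal.ofReal (|l n * (k : ℝ)| ^ q)) measurable_from_top
    rw [h1, hc, ← lintegral_const_mul _ measurable_from_top]
    refine lintegral_congr fun k => ?_
    rw [abs_mul, Nat.abs_cast, Real.mul_rpow (abs_nonneg _) (Nat.cast_nonneg _),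
      ENNReal.ofReal_mul (by positivity)]
  -- By Tonelli the expected value of the series is `∑ |l n|^q` times the `q`-th Poisson moment; a
  -- finite mean forces almost sure finiteness.
  have hfin : ∫⁻ ω, ∑' n, ENNReal.ofReal (|l n * (ω n : ℝ)| ^ q) ∂P ≠ ∞ := by
    rw [lintegral_tsum fun n => (hmeas n).aemeasurable]
    simp only [hval]
    rw [ENNReal.tsum_mul_right]
    exact ENNReal.mul_ne_top h.tsum_ofReal_ne_top hcf
  filter_upwards [ae_lt_top' (Measurable.tsum hmeas).aemeasurable hfin] with ω hω
  have := ENNReal.summable_toReal hω.ne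
  refine this.congr fun n => ?_
  rw [ENNReal.toReal_ofReal (by positivity)]

variable {p : ℝ} [Fact (1 ≤ p)] [MeasurableSpace (EllP p)] [BorelSpace (EllP p)]

lemma charFunDual_map_poissonMeasure_one (v : EllP p) (x : StrongDual ℝ (EllP p)) :
    charFunDual ((poissonMeasure 1).map fun k : ℕ => (k : ℝ) • v) x =
      Complex.exp (Complex.exp (Complex.I * (x v : ℝ)) - 1) := by
  have h := charFun_map_cast_poissonMeasure 1 (x v)
  rw [charFun_apply, integral_map .of_discrete (by fun_prop)] at h
  rw [charFunDual_apply, integral_map .of_discrete (by fun_prop)]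
  simp only [Real.inner_apply, NNReal.coe_one, Complex.ofReal_one, one_mul] at h
  simp only [map_smul, smul_eq_mul]
  rw [h, mul_comm Complex.I]

lemma charFunDual_map_sum_infinitePi (v : ℕ → EllP p) (N : ℕ) (x : StrongDual ℝ (EllP p)) :
    charFunDual ((Measure.infinitePi fun _ : ℕ => poissonMeasure 1).map
      fun ω : ℕ → ℕ => ∑ n ∈ Finset.range N, (ω n : ℝ) • v n) x =
      Complex.exp (∑ n ∈ Finset.range N, (Complex.exp (Complex.I * (x (v n) : ℝ)) - 1)) := by
  set P := Measure.infinitePi fun _ : ℕ => poissonMeasure 1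
  have hm : ∀ n, Measurable fun k : ℕ => (k : ℝ) • v n := fun n => measurable_from_top
  have hind : iIndepFun (fun (n : ℕ) (ω : ℕ → ℕ) => (ω n : ℝ) • v n) P :=
    iIndepFun_infinitePi (P := fun _ : ℕ => poissonMeasure 1)
      (X := fun n (k : ℕ) => (k : ℝ) • v n) hm
  have hmX : ∀ n, Measurable fun ω : ℕ → ℕ => (ω n : ℝ) • v n :=
    fun n => (hm n).comp (measurable_pi_apply n)
  rw [iIndepFun.charFunDual_map_fun_finsetSum_eq_prod (fun n _ => (hmX n).aemeasurable)
    (hind.restrict _), Finset.prod_apply, Complex.exp_sum]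
  refine Finset.prod_congr rfl fun n _ => ?_
  rw [← charFunDual_map_poissonMeasure_one,
    ← (measurePreserving_eval_infinitePi (fun _ : ℕ => poissonMeasure 1) n).map_eq,
    Measure.map_map (hm n) (measurable_pi_apply n)]
  rfl

/-- The measure is the law of the almost sure limit of the partial sums `∑ N_n l n e_n`; dominated
convergence passes their explicit characteristic functionals to the limit. -/
lemma exists_isCompoundPoisson (hp : p ≤ 2) {l : ℕ → ℝ} (h : Summable fun n => |l n| ^ p)
    (hpos : ∀ n, 0 < l n) : ∃ μ : Measure (EllP p), IsCompoundPoisson p l μ := by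
  set P := Measure.infinitePi fun _ : ℕ => poissonMeasure 1
  set S : ℕ → (ℕ → ℕ) → EllP p :=
    fun N ω => ∑ n ∈ Finset.range N, (ω n : ℝ) • (l n • basisVec p n) with hS
  have hSm : ∀ N, Measurable (S N) := fun N => by
    refine Finset.measurable_sum _ fun n _ => ?_
    have : Measurable fun k : ℕ => (k : ℝ) • (l n • basisVec p n) := measurable_from_top
    exact this.comp (measurable_pi_apply n)
  have hlim : ∀ᵐ ω ∂P, ∃ z, Tendsto (fun N => S N ω) atTop (𝓝 z) := by
    filter_upwards [ae_summable_rpow_infinitePi_poissonMeasure hp h]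
      with ω hω
    refine ⟨_, ((EllP.hasSum_of_summable hω).tendsto_sum_nat).congr fun N => ?_⟩
    simp only [hS, smul_smul, mul_comm]
  obtain ⟨X, hXm, hX⟩ := measurable_limit_of_tendsto_metrizable_ae
    (fun N => (hSm N).aemeasurable) hlim
  refine ⟨P.map X, (isCompoundPoisson_iff h hpos).mpr
    ⟨Measure.isProbabilityMeasure_map hXm.aemeasurable, fun x => ?_⟩⟩
  have h1 : Tendsto (fun N => charFunDual (P.map (S N)) x) atTop
      (𝓝 (charFunDual (P.map X) x)) := by
    have hcont : Continuous fun v : EllP p => Complex.exp ((x v : ℝ) * Complex.I) := by fun_prop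
    simp only [charFunDual_apply]
    rw [integral_map hXm.aemeasurable hcont.aestronglyMeasurable]
    simp_rw [integral_map (hSm _).aemeasurable hcont.aestronglyMeasurable]
    refine tendsto_integral_of_dominated_convergence (fun _ => 1)
      (fun N => (hcont.measurable.comp (hSm N)).aestronglyMeasurable) (integrable_const _)
      (fun N => Eventually.of_forall fun ω => ?_) ?_
    · rw [Complex.norm_exp_ofReal_mul_I]
    · filter_upwards [hX] with ω hω
      exact (hcont.tendsto _).comp hω
  refine tendsto_nhds_unique h1 ?_
  simp only [hS, P, charFunDual_map_sum_infinitePi]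
  exact (Complex.continuous_exp.tendsto _).comp
    (summable_poissonExponent h x).hasSum.tendsto_sum_nat

end Existence

/-! ### Mixing from asymptotic independence -/

section Mixing

/-- If `T` preserves `μ` and its `n`-th iterate is independent of continuous maps `P n` that
converge pointwise to the identity, then `T` is strongly mixing. -/
lemma isStronglyMixing_of_indepFun {E : Type*} [NormedAddCommGroup E]
    [MeasurableSpace E] [BorelSpace E] {μ : Measure E} [IsProbabilityMeasure μ]
    {T : E → E} (hT : MeasurePreserving T μ μ) {P : ℕ → E → E} (hP : ∀ n, Continuous (P n))
    (hlim : ∀ z, Tendsto (fun n => P n z) atTop (𝓝 z))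
    (hind : ∀ n, IndepFun (P n) T^[n] μ) : IsStronglyMixing T μ := by
  intro A B hA hB
  have hTn : ∀ n, MeasurePreserving T^[n] μ μ := fun n => hT.iterate n
  have key : Tendsto (fun n : ℕ => μ.real (A ∩ T^[n] ⁻¹' B)) atTop (𝓝 (μ.real A * μ.real B)) := by
    rw [Metric.tendsto_atTop]
    intro ε hε
    have hAint : Integrable (A.indicator fun _ => (1 : ℝ)) μ := (integrable_const 1).indicator hA
    -- Approximate the indicator of `A` in `L¹` by a bounded continuous `g`; continuity gives `g ∘ P
    -- n → g` in `L¹` too.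
    obtain ⟨g, hg, hgint⟩ := hAint.exists_boundedContinuous_integral_sub_le
      (show (0 : ℝ) < ε / 8 by positivity)
    have hgPint : ∀ n, Integrable (fun z => g (P n z)) μ := fun n =>
      Integrable.of_bound ((g.continuous.comp (hP n)).measurable.aestronglyMeasurable) ‖g‖
        (Eventually.of_forall fun z => g.norm_coe_le_norm _)
    have hd : Tendsto (fun n => ∫ z, ‖g z - g (P n z)‖ ∂μ) atTop (𝓝 0) := by
      have := tendsto_integral_of_dominated_convergence (μ := μ)
        (F := fun n z => ‖g z - g (P n z)‖) (f := fun _ => 0) (fun _ => ‖g‖ + ‖g‖)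
        (fun n => (hgint.sub (hgPint n)).norm.aestronglyMeasurable) (integrable_const _)
        (fun n => Eventually.of_forall fun z => ?_) (Eventually.of_forall fun z => ?_)
      · simpa using this
      · rw [norm_norm]
        exact (norm_sub_le _ _).trans (add_le_add (g.norm_coe_le_norm _) (g.norm_coe_le_norm _))
      · have h1 : Tendsto (fun n => g (P n z)) atTop (𝓝 (g z)) :=
          (g.continuous.tendsto z).comp (hlim z)
        simpa using (h1.const_sub (g z)).norm
    obtain ⟨N, hN⟩ := (Metric.tendsto_atTop.mp hd) (ε / 8) (by positivity)
    refine ⟨N, fun n hn => ?_⟩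
    have hdn : ∫ z, ‖g z - g (P n z)‖ ∂μ < ε / 8 := by
      have := hN n hn
      rw [Real.dist_0_eq_abs] at this
      exact (le_abs_self _).trans_lt this
    set S := T^[n] ⁻¹' B with hSdef
    have hS : MeasurableSet S := (hTn n).measurable hB
    have hμS : μ.real S = μ.real B := (hTn n).measureReal_preimage hB.nullMeasurableSet
    set h : E → ℝ := fun z => A.indicator (fun _ => (1 : ℝ)) z - g (P n z) with hh
    have hhint : Integrable h μ := hAint.sub (hgPint n)
    have hbound : ∫ z, ‖h z‖ ∂μ ≤ ε / 8 + ε / 8 := by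
      calc ∫ z, ‖h z‖ ∂μ
          ≤ ∫ z, (‖A.indicator (fun _ => (1 : ℝ)) z - g z‖ + ‖g z - g (P n z)‖) ∂μ := by
            refine integral_mono hhint.norm
              ((hAint.sub hgint).norm.add (hgint.sub (hgPint n)).norm) fun z => ?_
            exact norm_sub_le_norm_sub_add_norm_sub _ _ _
        _ = _ := integral_add (hAint.sub hgint).norm (hgint.sub (hgPint n)).norm
        _ ≤ _ := add_le_add hg hdn.le
    have hind' : ∫ z in S, g (P n z) ∂μ = (∫ z, g (P n z) ∂μ) * μ.real B := by
      have h1 := IndepFun.integral_fun_comp_mul_comp (hind n) (hP n).measurable.aemeasurable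
        (hTn n).measurable.aemeasurable (f := fun z => g z) (g := B.indicator fun _ => (1 : ℝ))
        g.continuous.aestronglyMeasurable
        ((measurable_const.indicator hB).aestronglyMeasurable)
      have h2 : ∫ z, B.indicator (fun _ => (1 : ℝ)) (T^[n] z) ∂μ = μ.real B := by
        rw [← hμS, ← integral_indicator_one hS]
        rfl
      rw [h2] at h1
      rw [← h1, ← integral_indicator hS]
      refine integral_congr_ae (Eventually.of_forall fun z => ?_)
      by_cases hz : z ∈ S
      · have hz' : T^[n] z ∈ B := hz
        simp [hz, hz']
      · have hz' : T^[n] z ∉ B := hz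
        simp [hz, hz']
    have hA1 : ∫ z, A.indicator (fun _ => (1 : ℝ)) z ∂μ = μ.real A := integral_indicator_one hA
    have hA2 : ∫ z in S, A.indicator (fun _ => (1 : ℝ)) z ∂μ = μ.real (A ∩ S) := by
      have := integral_indicator_one (μ := μ.restrict S) hA
      rw [measureReal_restrict_apply hA] at this
      exact this
    -- Independence makes the contributions of `g ∘ P n` cancel, leaving only the error `h`, whose
    -- `L¹` norm is at most `ε / 4`.
    have hdecomp : μ.real (A ∩ S) - μ.real A * μ.real B =
        (∫ z in S, h z ∂μ) - (∫ z, h z ∂μ) * μ.real B := by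
      rw [hh, integral_sub hAint (hgPint n), integral_sub hAint.integrableOn
        (hgPint n).integrableOn, hind', hA1, hA2]
      ring
    rw [Real.dist_eq, hdecomp]
    have e1 : |∫ z in S, h z ∂μ| ≤ ε / 4 :=
      calc |∫ z in S, h z ∂μ| ≤ ∫ z in S, ‖h z‖ ∂μ := abs_integral_le_integral_abs
        _ ≤ ∫ z, ‖h z‖ ∂μ :=
          setIntegral_le_integral hhint.norm (Eventually.of_forall fun _ => norm_nonneg _)
        _ ≤ ε / 4 := by linarith
    have e2 : |(∫ z, h z ∂μ) * μ.real B| ≤ ε / 4 := by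
      have h1 : |∫ z, h z ∂μ| ≤ ∫ z, ‖h z‖ ∂μ := abs_integral_le_integral_abs
      have h2 : μ.real B ≤ 1 := measureReal_le_one
      rw [abs_mul, abs_of_nonneg (measureReal_nonneg (μ := μ) (s := B))]
      calc |∫ z, h z ∂μ| * μ.real B ≤ |∫ z, h z ∂μ| * 1 := by gcongr
        _ ≤ ε / 4 := by linarith
    calc _ ≤ |∫ z in S, h z ∂μ| + |(∫ z, h z ∂μ) * μ.real B| := abs_sub _ _
      _ < ε := by linarith
  have h2 : ∀ n : ℕ, μ (A ∩ T^[n] ⁻¹' B) ≠ ∞ := fun n => measure_ne_top _ _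
  rw [← ENNReal.tendsto_toReal_iff h2 (ENNReal.mul_ne_top (measure_ne_top _ _)
    (measure_ne_top _ _)), ENNReal.toReal_mul]
  exact key

end Mixing

/-! ### The weighted shift and its action on the atoms -/

section Shift

variable {p : ℝ} [Fact (1 ≤ p)]

/-- Weighted backward shifts with bounded weights act continuously on `ℓ^p`. -/
lemma exists_weightedBackwardShift (w : ℕ → ℝ) {C : ℝ} (hC : ∀ n, |w n| ≤ C) :
    ∃ T : EllP p →L[ℝ] EllP p, ∀ z n, T z n = w n * z (n + 1) := by
  have hC0 : 0 ≤ C := (abs_nonneg _).trans (hC 0)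
  have hp0 := EllP.pos_exponent p
  have hp0' : 0 < (ENNReal.ofReal p).toReal := by rwa [toReal_ofReal_of_one_le]
  have hle : ∀ (z : EllP p) (n : ℕ), ‖w n * z (n + 1)‖ ^ p ≤ C ^ p * ‖z (n + 1)‖ ^ p := by
    intro z n
    rw [norm_mul, Real.mul_rpow (norm_nonneg _) (norm_nonneg _)]
    gcongr
    exact hC n
  have hz : ∀ z : EllP p, HasSum (fun n => ‖z n‖ ^ p) (‖z‖ ^ p) := by
    intro z
    have := lp.hasSum_norm hp0' z
    rwa [toReal_ofReal_of_one_le] at this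
  have hz1 : ∀ z : EllP p, Summable fun n => C ^ p * ‖z (n + 1)‖ ^ p := fun z =>
    (((summable_nat_add_iff 1).mpr (hz z).summable)).mul_left _
  have hmem : ∀ z : EllP p,
      Memℓp (E := fun _ : ℕ => ℝ) (fun n => w n * z (n + 1)) (ENNReal.ofReal p) := by
    intro z
    refine memℓp_gen ?_
    rw [toReal_ofReal_of_one_le]
    exact Summable.of_nonneg_of_le (fun n => by positivity) (hle z) (hz1 z)
  let T₀ : EllP p →ₗ[ℝ] EllP p :=
    { toFun := fun z => ⟨_, hmem z⟩
      map_add' := fun a b => by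
        ext n
        exact mul_add (w n) (a (n + 1)) (b (n + 1))
      map_smul' := fun c a => by
        ext n
        exact mul_left_comm (w n) c (a (n + 1)) }
  refine ⟨T₀.mkContinuous C fun z => ?_, fun z n => rfl⟩
  refine lp.norm_le_of_tsum_le hp0' (by positivity) ?_
  rw [toReal_ofReal_of_one_le, Real.mul_rpow hC0 (norm_nonneg _)]
  calc ∑' n, ‖T₀ z n‖ ^ p ≤ ∑' n, C ^ p * ‖z (n + 1)‖ ^ p :=
        (Summable.of_nonneg_of_le (fun n => by positivity) (hle z) (hz1 z)).tsum_le_tsum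
          (hle z) (hz1 z)
    _ = C ^ p * ∑' n, ‖z (n + 1)‖ ^ p := tsum_mul_left
    _ ≤ C ^ p * ‖z‖ ^ p := by
        gcongr
        rw [← (hz z).tsum_eq, (hz z).summable.tsum_eq_zero_add]
        exact le_add_of_nonneg_left (by positivity)

omit [Fact (1 ≤ p)] in
lemma basisVec_apply (n k : ℕ) : basisVec p n k = if k = n then 1 else 0 := by
  rw [basisVec, lp.single_apply, Pi.single_apply]

lemma existsUnique_isWeightedBackwardShift {γ : ℝ} (hγ : 0 ≤ γ) :
    ∃! T : EllP p →L[ℝ] EllP p, IsWeightedBackwardShift p γ T := by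
  have hp0 := EllP.pos_exponent p
  -- The weights are largest at `n = 0`, whence the bound `2 ^ (γ / p)`.
  obtain ⟨T, hT⟩ := exists_weightedBackwardShift (p := p)
    (fun n : ℕ => (1 + 1 / ((n : ℝ) + 1)) ^ (γ / p)) (C := 2 ^ (γ / p)) fun n => by
      rw [abs_of_nonneg (by positivity)]
      gcongr
      have : 1 / ((n : ℝ) + 1) ≤ 1 := by
        rw [div_le_one (by positivity)]
        linarith [Nat.cast_nonneg (α := ℝ) n]
      linarith
  refine ⟨T, ⟨?_, fun n => ?_⟩, fun S hS => EllP.clm_ext fun n => ?_⟩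
  · ext k
    rw [hT, basisVec_apply, if_neg (Nat.succ_ne_zero k), mul_zero]
    rfl
  · ext k
    rw [hT, basisVec_apply, lp.coeFn_smul, Pi.smul_apply, basisVec_apply, smul_eq_mul]
    by_cases hk : k = n
    · subst hk; simp
    · simp [hk]
  · rcases n with _ | n
    · rw [hS.map_zero]
      ext k
      rw [hT, basisVec_apply, if_neg (Nat.succ_ne_zero k), mul_zero]
      rfl
    · rw [hS.map_succ]
      ext k
      rw [hT, basisVec_apply, lp.coeFn_smul, Pi.smul_apply, basisVec_apply, smul_eq_mul]
      by_cases hk : k = n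
      · subst hk; simp
      · simp [hk]

omit [Fact (1 ≤ p)] in
lemma lambdaSeq_pos {γ lam0 : ℝ} (hlam0 : 0 < lam0) (n : ℕ) : 0 < lambdaSeq p γ lam0 n := by
  unfold lambdaSeq
  positivity

/-- Used with `s = 1` for summability and with `s = 1 / 2` for the codifference bound. -/
lemma lambdaSeq_rpow {γ lam0 : ℝ} (hlam0 : 0 < lam0) (s : ℝ) (n : ℕ) :
    lambdaSeq p γ lam0 n ^ (p * s) = lam0 ^ (p * s) * ((n : ℝ) + 1) ^ (-(γ * s)) := by
  have hp0 := EllP.pos_exponent p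
  rw [lambdaSeq, Real.div_rpow hlam0.le (by positivity), ← Real.rpow_mul (by positivity),
    Real.rpow_neg (by positivity), div_eq_mul_inv]
  congr 3
  field_simp

lemma summable_lambdaSeq_rpow {γ lam0 : ℝ} (hγ : 1 < γ) (hlam0 : 0 < lam0) :
    Summable fun n => |lambdaSeq p γ lam0 n| ^ p := by
  have h1 : Summable fun n : ℕ => ((n + 1 : ℕ) : ℝ) ^ (-γ) :=
    (summable_nat_add_iff 1).mpr (Real.summable_nat_rpow.mpr (by linarith))
  refine (h1.mul_left (lam0 ^ p)).congr fun n => ?_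
  rw [abs_of_pos (lambdaSeq_pos hlam0 n)]
  have := lambdaSeq_rpow (p := p) (γ := γ) hlam0 1 n
  simp only [mul_one] at this
  rw [this]
  push_cast
  rfl

/-- The weight `((n+2)/(n+1))^{γ/p}` is precisely the ratio of consecutive values of the sequence.
-/
lemma IsWeightedBackwardShift.map_lambdaSeq_succ {γ lam0 : ℝ} {T : EllP p →L[ℝ] EllP p}
    (hT : IsWeightedBackwardShift p γ T) (n : ℕ) :
    T (lambdaSeq p γ lam0 (n + 1) • basisVec p (n + 1)) = lambdaSeq p γ lam0 n • basisVec p n := by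
  rw [map_smul, hT.map_succ, smul_smul]
  congr 1
  have h1 : (1 + 1 / ((n : ℝ) + 1)) = ((n : ℝ) + 1 + 1) / ((n : ℝ) + 1) := by
    field_simp
  rw [h1, Real.div_rpow (by positivity) (by positivity), lambdaSeq, lambdaSeq]
  push_cast
  have h2 : ((n : ℝ) + 1 + 1) ^ (γ / p) ≠ 0 := by positivity
  field_simp

lemma IsWeightedBackwardShift.pow_map_lambdaSeq_add {γ lam0 : ℝ} {T : EllP p →L[ℝ] EllP p}
    (hT : IsWeightedBackwardShift p γ T) (n k : ℕ) :
    (T ^ n) (lambdaSeq p γ lam0 (k + n) • basisVec p (k + n)) =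
      lambdaSeq p γ lam0 k • basisVec p k := by
  induction n with
  | zero => simp
  | succ n ih =>
    rw [pow_succ, mul_apply_eq_comp, ← add_assoc, hT.map_lambdaSeq_succ, ih]

lemma IsWeightedBackwardShift.pow_map_basisVec_of_lt {γ : ℝ} {T : EllP p →L[ℝ] EllP p}
    (hT : IsWeightedBackwardShift p γ T) {n k : ℕ} (hk : k < n) :
    (T ^ n) (basisVec p k) = 0 := by
  induction n generalizing k with
  | zero => omega
  | succ n ih =>
    rw [pow_succ, mul_apply_eq_comp]
    rcases k with _ | k
    · rw [hT.map_zero, _root_.map_zero]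
    · rw [hT.map_succ, map_smul, ih (by omega), smul_zero]

end Shift

/-! ### Invariance, independence of coordinate blocks, and mixing -/

section Dynamics

variable {p : ℝ} [Fact (1 ≤ p)]

/-- The killed vector `e_0` contributes `e^0 - 1 = 0`, and the remaining terms are the original
series reindexed. -/
lemma poissonExponent_comp_of_shift {l : ℕ → ℝ} (h : Summable fun n => |l n| ^ p)
    {T : EllP p →L[ℝ] EllP p} (h0 : T (basisVec p 0) = 0)
    (hs : ∀ n, T (l (n + 1) • basisVec p (n + 1)) = l n • basisVec p n)
    (x : StrongDual ℝ (EllP p)) : poissonExponent l (x ∘L T) = poissonExponent l x := by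
  rw [poissonExponent, (summable_poissonExponent h _).tsum_eq_zero_add, poissonExponent]
  simp only [ContinuousLinearMap.comp_apply, hs]
  simp [h0]

lemma poissonExponent_add_of_disjoint {l : ℕ → ℝ} (h : Summable fun n => |l n| ^ p)
    {x y : StrongDual ℝ (EllP p)} (hxy : ∀ n, x (basisVec p n) = 0 ∨ y (basisVec p n) = 0) :
    poissonExponent l (x + y) = poissonExponent l x + poissonExponent l y := by
  rw [poissonExponent, poissonExponent, poissonExponent,
    ← (summable_poissonExponent h x).tsum_add (summable_poissonExponent h y)]
  refine tsum_congr fun n => ?_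
  rcases hxy n with h0 | h0 <;> simp [h0]

/-- The projection of `ℓ^p` onto the span of the first `n` basis vectors. -/
def truncationCLM (p : ℝ) [Fact (1 ≤ p)] (n : ℕ) : EllP p →L[ℝ] EllP p :=
  ∑ k ∈ Finset.range n,
    (lp.evalCLM ℝ (fun _ : ℕ => ℝ) (ENNReal.ofReal p) k).smulRight (basisVec p k)

lemma truncationCLM_apply (n : ℕ) (z : EllP p) :
    truncationCLM p n z = ∑ k ∈ Finset.range n, z k • basisVec p k := by
  rw [truncationCLM, _root_.sum_apply]
  rfl

lemma truncationCLM_basisVec_of_le {n k : ℕ} (h : n ≤ k) :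
    truncationCLM p n (basisVec p k) = 0 := by
  rw [truncationCLM_apply]
  refine Finset.sum_eq_zero fun j hj => ?_
  rw [basisVec_apply, if_neg (by have := Finset.mem_range.mp hj; omega), zero_smul]

variable [MeasurableSpace (EllP p)] [BorelSpace (EllP p)] {l : ℕ → ℝ} {μ : Measure (EllP p)}

lemma measurePreserving_of_shift (h : Summable fun n => |l n| ^ p) (hpos : ∀ n, 0 < l n)
    (hμ : IsCompoundPoisson p l μ) {T : EllP p →L[ℝ] EllP p} (h0 : T (basisVec p 0) = 0)
    (hs : ∀ n, T (l (n + 1) • basisVec p (n + 1)) = l n • basisVec p n) :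
    MeasurePreserving T μ μ := by
  refine ⟨T.measurable, IsCompoundPoisson.unique ?_ hμ⟩
  obtain ⟨hprob, hchar⟩ := (isCompoundPoisson_iff h hpos).mp hμ
  refine (isCompoundPoisson_iff h hpos).mpr
    ⟨Measure.isProbabilityMeasure_map T.measurable.aemeasurable, fun x => ?_⟩
  rw [charFunDual_map, hchar, poissonExponent_comp_of_shift h h0 hs]

/-- A functional on the product splits into one through `R` and one through `S`. No basis vector is
seen by both, so the exponents add and the joint characteristic functional factorises. -/
lemma indepFun_of_disjoint (h : Summable fun n => |l n| ^ p) (hpos : ∀ n, 0 < l n)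
    (hμ : IsCompoundPoisson p l μ) {R S : EllP p →L[ℝ] EllP p}
    (hRS : ∀ n, R (basisVec p n) = 0 ∨ S (basisVec p n) = 0) : IndepFun R S μ := by
  obtain ⟨hprob, hchar⟩ := (isCompoundPoisson_iff h hpos).mp hμ
  rw [indepFun_iff_charFunDual_prod R.measurable.aemeasurable S.measurable.aemeasurable]
  intro L
  have h1 : (fun z => (R z, S z)) = ⇑(R.prod S) := rfl
  rw [h1, charFunDual_map, charFunDual_map, charFunDual_map, hchar, hchar, hchar,
    ← Complex.exp_add, ← poissonExponent_add_of_disjoint h]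
  · congr 2
    ext z
    simp [← map_add]
  · intro n
    rcases hRS n with h0 | h0
    · left; simp [h0, ← Prod.zero_eq_mk]
    · right; simp [h0, ← Prod.zero_eq_mk]

lemma isStronglyMixing_of_shift (h : Summable fun n => |l n| ^ p) (hpos : ∀ n, 0 < l n)
    (hμ : IsCompoundPoisson p l μ) {T : EllP p →L[ℝ] EllP p} (hT : MeasurePreserving T μ μ)
    (h0 : ∀ n k, k < n → (T ^ n) (basisVec p k) = 0) : IsStronglyMixing T μ := by
  have := hμ.isProbabilityMeasure
  refine isStronglyMixing_of_indepFun hT (P := fun n => truncationCLM p n)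
    (fun n => (truncationCLM p n).continuous) (fun z => ?_) fun n => ?_
  · simp only [truncationCLM_apply]
    exact (EllP.hasSum_smul_basisVec z).tendsto_sum_nat
  · rw [← FunLike.coe_pow_eq_iterate]
    refine indepFun_of_disjoint h hpos hμ fun k => ?_
    rcases lt_or_ge k n with hk | hk
    · exact Or.inr (h0 n k hk)
    · exact Or.inl (truncationCLM_basisVec_of_le hk)

end Dynamics

/-! ### Comparison of the shifted sum with a beta integral -/

section BetaSum

lemma intervalIntegrable_and_integral_eq_beta {a b : ℝ} (ha : 0 < a) (hb : 0 < b) :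
    IntervalIntegrable (fun u : ℝ => u ^ (a - 1) * (1 - u) ^ (b - 1)) volume 0 1 ∧
      ∫ u in (0 : ℝ)..1, u ^ (a - 1) * (1 - u) ^ (b - 1) = beta a b := by
  have hconv := Complex.betaIntegral_convergent (u := a) (v := b) (by simpa) (by simpa)
  have heq : ∀ u ∈ Set.Ioc (0 : ℝ) 1,
      ((u : ℂ) ^ ((a : ℂ) - 1) * (1 - (u : ℂ)) ^ ((b : ℂ) - 1)) =
        ((u ^ (a - 1) * (1 - u) ^ (b - 1) : ℝ) : ℂ) := by
    rintro u ⟨h0, h1⟩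
    rw [Complex.ofReal_mul, Complex.ofReal_cpow h0.le, Complex.ofReal_cpow (by linarith)]
    push_cast
    rfl
  have hI : Complex.betaIntegral a b =
      ((∫ u in (0 : ℝ)..1, u ^ (a - 1) * (1 - u) ^ (b - 1) : ℝ) : ℂ) := by
    rw [Complex.betaIntegral, ← intervalIntegral.integral_ofReal]
    refine intervalIntegral.integral_congr_ae (Eventually.of_forall fun u hu => ?_)
    rw [Set.uIoc_of_le zero_le_one] at hu
    exact heq u hu
  refine ⟨?_, ?_⟩
  · rw [intervalIntegrable_iff_integrableOn_Ioc_of_le zero_le_one] at hconv ⊢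
    refine (Integrable.re hconv).congr ?_
    filter_upwards [ae_restrict_mem measurableSet_Ioc] with u hu
    rw [heq u hu]
    rfl
  · rw [beta_eq_betaIntegralReal a b ha hb, hI, Complex.ofReal_re]

/-- Comparison of `∑ (j+1)^{-γ/2} (j+n+1)^{-γ/2}` with the beta integral in the variable
`u = t / (t + n)`. -/
lemma sum_rpow_mul_rpow_le_beta {γ : ℝ} (h1 : 1 < γ) (h2 : γ < 2) {n : ℕ} (hn : 1 ≤ n) (N : ℕ) :
    ∑ j ∈ Finset.range N, ((j : ℝ) + 1) ^ (-(γ / 2)) * ((j : ℝ) + n + 1) ^ (-(γ / 2)) ≤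
      beta (1 - γ / 2) (γ - 1) * (n : ℝ) ^ (-(γ - 1)) := by
  have hn0 : (0 : ℝ) < n := by exact_mod_cast hn
  obtain ⟨hint, hval⟩ := intervalIntegrable_and_integral_eq_beta (a := 1 - γ / 2) (b := γ - 1)
    (by linarith) (by linarith)
  set f : ℝ → ℝ := fun u => u ^ (1 - γ / 2 - 1) * (1 - u) ^ (γ - 1 - 1) with hf
  set u : ℕ → ℝ := fun j => (j : ℝ) / ((j : ℝ) + n) with hu
  have hu0 : ∀ j, 0 ≤ u j := fun j => by simp only [hu]; positivity
  have hu1 : ∀ j, u j ≤ 1 := fun j => by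
    simp only [hu]
    rw [div_le_one (by positivity)]
    linarith
  have hdiff : ∀ j, u (j + 1) - u j = n / (((j : ℝ) + n) * ((j : ℝ) + n + 1)) := fun j => by
    simp only [hu]
    push_cast
    rw [add_right_comm (j : ℝ) 1]
    have : (0 : ℝ) < (j : ℝ) + n := by positivity
    field_simp
    ring
  have hmono : ∀ j, u j ≤ u (j + 1) := fun j => by
    have : 0 ≤ u (j + 1) - u j := by rw [hdiff]; positivity
    linarith
  have hintj : ∀ j, IntervalIntegrable f volume (u j) (u (j + 1)) := fun j =>
    hint.mono_set (by
      rw [Set.uIcc_of_le (hmono j), Set.uIcc_of_le zero_le_one]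
      exact Set.Icc_subset_Icc (hu0 j) (hu1 _))
  have hterm : ∀ j : ℕ, (n : ℝ) ^ (γ - 1) *
      (((j : ℝ) + 1) ^ (-(γ / 2)) * ((j : ℝ) + n + 1) ^ (-(γ / 2))) ≤
        ∫ t in u j..u (j + 1), f t := by
    intro j
    set M : ℝ := (j : ℝ) + n with hM
    have hM0 : 0 < M := by positivity
    -- On this interval `t^{-γ/2}` is smallest at the right end and `(1-t)^{γ-2}`, with `γ < 2`, at
    -- the left end. The mixed choice also avoids the singularities at 0 and 1.
    have hlow : (u (j + 1) - u j) * (u (j + 1) ^ (-(γ / 2)) * (1 - u j) ^ (γ - 2)) ≤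
        ∫ t in u j..u (j + 1), f t := by
      rw [← smul_eq_mul, ← intervalIntegral.integral_const]
      refine intervalIntegral.integral_mono_on_of_le_Ioo (hmono j) intervalIntegrable_const
        (hintj j) fun t ht => ?_
      have ht0 : 0 < t := (hu0 j).trans_lt ht.1
      have ht1 : 0 < 1 - t := by linarith [ht.2, hu1 (j + 1)]
      have e1 : 1 - γ / 2 - 1 = -(γ / 2) := by ring
      have e2 : γ - 1 - 1 = γ - 2 := by ring
      simp only [hf, e1, e2]
      refine mul_le_mul ?_ ?_ (by have := hu1 j; exact Real.rpow_nonneg (by linarith) _)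
        (by positivity)
      · exact Real.rpow_le_rpow_of_nonpos ht0 ht.2.le (by linarith)
      · exact Real.rpow_le_rpow_of_nonpos ht1 (by linarith [ht.1]) (by linarith)
    refine le_trans ?_ hlow
    have e3 : u (j + 1) = ((j : ℝ) + 1) / (M + 1) := by
      simp only [hu, hM]
      push_cast
      ring_nf
    have e4 : 1 - u j = n / M := by
      simp only [hu]
      rw [← hM]
      field_simp
      rw [hM]
      ring
    rw [hdiff, e3, e4, Real.div_rpow (by positivity) (by positivity),
      Real.div_rpow (by positivity) (by positivity), ← hM]
    have e5 : (n : ℝ) ^ (γ - 1) = n ^ (γ - 2) * n := by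
      rw [← Real.rpow_add_one hn0.ne']
      ring_nf
    have e6 : M ^ (γ - 1) = M ^ (γ - 2) * M := by
      rw [← Real.rpow_add_one hM0.ne']
      ring_nf
    have e7 : (M + 1) ^ (γ - 1) = ((M + 1) ^ (-(γ / 2)))⁻¹ * ((M + 1) ^ (-(γ / 2)))⁻¹ *
        (M + 1)⁻¹ := by
      rw [← Real.rpow_neg (by positivity), ← Real.rpow_neg_one (M + 1),
        ← Real.rpow_add (by positivity), ← Real.rpow_add (by positivity)]
      ring_nf
    have e8 : M ^ (γ - 1) ≤ (M + 1) ^ (γ - 1) :=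
      Real.rpow_le_rpow hM0.le (by linarith) (by linarith)
    have hA : 0 < ((j : ℝ) + 1) ^ (-(γ / 2)) := by positivity
    have hB : 0 < (M + 1) ^ (-(γ / 2)) := by positivity
    have hC : 0 < (n : ℝ) ^ (γ - 2) := by positivity
    have hD : 0 < M ^ (γ - 2) := by positivity
    rw [e6, e7] at e8
    rw [e5]
    set A := ((j : ℝ) + 1) ^ (-(γ / 2))
    set B := (M + 1) ^ (-(γ / 2))
    set C := (n : ℝ) ^ (γ - 2)
    set D := M ^ (γ - 2)
    calc C * n * (A * B) = (C * n * A * B) / (D * M) * (D * M) := by field_simp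
      _ ≤ (C * n * A * B) / (D * M) * (B⁻¹ * B⁻¹ * (M + 1)⁻¹) := by gcongr
      _ = n / (M * (M + 1)) * (A / B * (C / D)) := by field_simp
  have hsum : (n : ℝ) ^ (γ - 1) * ∑ j ∈ Finset.range N,
      ((j : ℝ) + 1) ^ (-(γ / 2)) * ((j : ℝ) + n + 1) ^ (-(γ / 2)) ≤
        beta (1 - γ / 2) (γ - 1) := by
    rw [Finset.mul_sum, ← hval]
    refine (Finset.sum_le_sum fun j _ => hterm j).trans ?_
    rw [intervalIntegral.sum_integral_adjacent_intervals fun j _ => hintj j]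
    refine intervalIntegral.integral_mono_interval (hu0 0) ?_ (hu1 N) ?_ hint
    · exact monotone_nat_of_le_succ hmono (Nat.zero_le N)
    · filter_upwards [ae_restrict_mem measurableSet_Ioc] with t ht
      have : 0 ≤ 1 - t := by linarith [ht.2]
      exact mul_nonneg (Real.rpow_nonneg ht.1.le _) (Real.rpow_nonneg this _)
  rw [Real.rpow_neg hn0.le, ← div_eq_mul_inv, le_div_iff₀ (by positivity), mul_comm]
  exact hsum

end BetaSum

/-! ### The distinguished logarithm and decay of the codifference -/

section Codifference

/-- Both logarithms lift the same map through the covering `exp : ℂ → ℂ \ {0}`; on the connected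
dual, lifts that agree at 0 coincide. -/
lemma IsDistinguishedLog.unique {E : Type*} [NormedAddCommGroup E] [NormedSpace ℝ E]
    [MeasurableSpace E] {μ : Measure E} {ψ φ : StrongDual ℝ E → ℂ}
    (hψ : IsDistinguishedLog μ ψ) (hφ : IsDistinguishedLog μ φ) : ψ = φ := by
  refine Complex.isCoveringMap_exp.eq_of_comp_eq hψ.continuous hφ.continuous ?_ 0
    (hψ.map_zero.trans hφ.map_zero.symm)
  funext x
  exact Subtype.ext ((hψ.exp_eq x).trans (hφ.exp_eq x).symm)

lemma IsDistinguishedLog.logCharFunctional_eq {E : Type*} [NormedAddCommGroup E]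
    [NormedSpace ℝ E] [MeasurableSpace E] {μ : Measure E} {ψ : StrongDual ℝ E → ℂ}
    (hψ : IsDistinguishedLog μ ψ) : logCharFunctional μ = ψ := by
  have h : ∃ ψ : StrongDual ℝ E → ℂ, IsDistinguishedLog μ ψ := ⟨ψ, hψ⟩
  rw [logCharFunctional, dif_pos h]
  exact h.choose_spec.unique hψ

/-- Geometric interpolation between the bounds `2` and `|t|`. -/
lemma norm_cexp_I_mul_sub_one_le_rpow {s : ℝ} (hs0 : 0 ≤ s) (hs1 : s ≤ 1) (t : ℝ) :
    ‖Complex.exp (Complex.I * t) - 1‖ ≤ 2 ^ (1 - s) * |t| ^ s := by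
  set a := ‖Complex.exp (Complex.I * t) - 1‖
  have h1 : a ≤ |t| := Real.norm_exp_I_mul_ofReal_sub_one_le
  have h2 : a ≤ 2 := by
    refine (norm_sub_le _ _).trans ?_
    rw [Complex.norm_exp_I_mul_ofReal, norm_one]
    norm_num
  have h0 : 0 ≤ a := norm_nonneg _
  calc a = a ^ (1 - s) * a ^ s := by
        rw [← Real.rpow_add_of_nonneg h0 (by linarith) hs0, sub_add_cancel, Real.rpow_one]
    _ ≤ 2 ^ (1 - s) * |t| ^ s := by
        have : 0 ≤ 1 - s := by linarith
        gcongr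

variable {p : ℝ} [Fact (1 ≤ p)] [MeasurableSpace (EllP p)] [BorelSpace (EllP p)]
  {l : ℕ → ℝ} {μ : Measure (EllP p)}

lemma isDistinguishedLog_poissonExponent (h : Summable fun n => |l n| ^ p) (hpos : ∀ n, 0 < l n)
    (hμ : IsCompoundPoisson p l μ) : IsDistinguishedLog μ (poissonExponent l) where
  continuous := continuous_poissonExponent h
  map_zero := poissonExponent_zero
  exp_eq x := (((isCompoundPoisson_iff h hpos).mp hμ).2 x).symm

/-- Termwise this is `(ab - 1) - (a - 1) - (b - 1) = (a - 1)(b - 1)`. -/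
lemma hasSum_codifference (h : Summable fun n => |l n| ^ p) (hpos : ∀ n, 0 < l n)
    (hμ : IsCompoundPoisson p l μ) (x y : StrongDual ℝ (EllP p)) :
    HasSum (fun k => (Complex.exp (Complex.I * (x (l k • basisVec p k) : ℝ)) - 1) *
      (Complex.exp (Complex.I * ((-y) (l k • basisVec p k) : ℝ)) - 1)) (codifference μ x y) := by
  rw [codifference, (isDistinguishedLog_poissonExponent h hpos hμ).logCharFunctional_eq]
  refine HasSum.congr_fun ((((summable_poissonExponent h (x - y)).hasSum.sub
    (summable_poissonExponent h x).hasSum).sub (summable_poissonExponent h (-y)).hasSum))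
    fun k => ?_
  have : Complex.exp (Complex.I * ((x - y) (l k • basisVec p k) : ℝ)) =
      Complex.exp (Complex.I * (x (l k • basisVec p k) : ℝ)) *
        Complex.exp (Complex.I * ((-y) (l k • basisVec p k) : ℝ)) := by
    rw [← Complex.exp_add, sub_eq_add_neg, _root_.add_apply]
    push_cast
    ring_nf
  rw [this]
  ring

/-- The auxiliary exponent `δ` serves both regimes: `δ = γ` when `γ < 2`, and `δ = 2 - ε` otherwise,
since the beta comparison needs an exponent below 2. -/
lemma norm_codifference_comp_pow_le (hp : p ≤ 2) {γ lam0 δ : ℝ} (hγ : 1 < γ) (hlam0 : 0 < lam0)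
    (hδ1 : 1 < δ) (hδ2 : δ < 2) (hδγ : δ ≤ γ) {T : EllP p →L[ℝ] EllP p}
    (hT : IsWeightedBackwardShift p γ T) (hμ : IsCompoundPoisson p (lambdaSeq p γ lam0) μ)
    {n : ℕ} (hn : 1 ≤ n) (x y : StrongDual ℝ (EllP p)) :
    ‖codifference μ x (y ∘L (T ^ n))‖ ≤
      2 ^ (2 - p) * lam0 ^ p * beta (1 - δ / 2) (δ - 1) * (n : ℝ) ^ (-(δ - 1)) *
        (‖x‖ ^ (p / 2) * ‖y‖ ^ (p / 2)) := by
  have hp0 := EllP.pos_exponent p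
  have hl := summable_lambdaSeq_rpow (p := p) hγ hlam0
  have hpos := lambdaSeq_pos (p := p) (γ := γ) hlam0
  set l := lambdaSeq p γ lam0
  set F : ℕ → ℂ := fun j =>
    (Complex.exp (Complex.I * (x (l (j + n) • basisVec p (j + n)) : ℝ)) - 1) *
      (Complex.exp (Complex.I * ((-y) (l j • basisVec p j) : ℝ)) - 1) with hF
  have hsum : HasSum F (codifference μ x (y ∘L (T ^ n))) := by
    have h1 := hasSum_codifference hl hpos hμ x (y ∘L (T ^ n))
    -- The first `n` terms vanish because `T ^ n` kills those basis vectors.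
    rw [← hasSum_nat_add_iff' n] at h1
    have h0 : ∑ k ∈ Finset.range n,
        (Complex.exp (Complex.I * (x (l k • basisVec p k) : ℝ)) - 1) *
          (Complex.exp (Complex.I * ((-(y ∘L (T ^ n))) (l k • basisVec p k) : ℝ)) - 1) = 0 :=
      Finset.sum_eq_zero fun k hk => by
        simp [hT.pow_map_basisVec_of_lt (Finset.mem_range.mp hk)]
    rw [h0, sub_zero] at h1
    refine h1.congr_fun fun j => ?_
    simp only [hF]
    rw [neg_apply, neg_apply, ContinuousLinearMap.comp_apply, hT.pow_map_lambdaSeq_add]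
  have hpow : ∀ j : ℕ, l j ^ (p / 2) = lam0 ^ (p / 2) * ((j : ℝ) + 1) ^ (-(γ / 2)) := fun j => by
    have := lambdaSeq_rpow (p := p) (γ := γ) hlam0 (1 / 2) j
    simpa only [mul_one_div] using this
  have hfac : ∀ (z : StrongDual ℝ (EllP p)) (j : ℕ),
      ‖Complex.exp (Complex.I * (z (l j • basisVec p j) : ℝ)) - 1‖ ≤
        2 ^ (1 - p / 2) * (lam0 ^ (p / 2) * ‖z‖ ^ (p / 2) * ((j : ℝ) + 1) ^ (-(δ / 2))) := by
    intro z j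
    refine (norm_cexp_I_mul_sub_one_le_rpow (s := p / 2) (by positivity) (by linarith) _).trans ?_
    have hz : |z (l j • basisVec p j)| ≤ l j * ‖z‖ := by
      refine (z.le_opNorm _).trans ?_
      rw [norm_smul, norm_basisVec, mul_one, Real.norm_of_nonneg (hpos j).le, mul_comm]
    calc 2 ^ (1 - p / 2) * |z (l j • basisVec p j)| ^ (p / 2)
        ≤ 2 ^ (1 - p / 2) * (l j * ‖z‖) ^ (p / 2) := by gcongr
      _ = 2 ^ (1 - p / 2) * (lam0 ^ (p / 2) * ‖z‖ ^ (p / 2) * ((j : ℝ) + 1) ^ (-(γ / 2))) := by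
          rw [Real.mul_rpow (hpos j).le (norm_nonneg _), hpow]
          ring
      -- Since `j + 1 ≥ 1`, lowering `γ` to `δ` only enlarges the power.
      _ ≤ _ := by
          gcongr
          linarith [Nat.cast_nonneg (α := ℝ) j]
  set c : ℝ := 2 ^ (2 - p) * lam0 ^ p * (‖x‖ ^ (p / 2) * ‖y‖ ^ (p / 2)) with hc
  have hc0 : 0 ≤ c := by positivity
  have hbound : ∀ j : ℕ, ‖F j‖ ≤
      c * (((j : ℝ) + 1) ^ (-(δ / 2)) * ((j : ℝ) + n + 1) ^ (-(δ / 2))) := by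
    intro j
    have e1 := hfac x (j + n)
    have e2 := hfac (-y) j
    rw [norm_neg] at e2
    push_cast at e1
    have e3 : (2 : ℝ) ^ (2 - p) = 2 ^ (1 - p / 2) * 2 ^ (1 - p / 2) := by
      rw [← Real.rpow_add two_pos]
      ring_nf
    have e4 : lam0 ^ p = lam0 ^ (p / 2) * lam0 ^ (p / 2) := by
      rw [← Real.rpow_add hlam0, add_halves]
    rw [hF, norm_mul]
    refine (mul_le_mul e1 e2 (norm_nonneg _) (by positivity)).trans (le_of_eq ?_)
    rw [hc, e3, e4]
    ring
  have hpartial : ∀ N, ∑ j ∈ Finset.range N, ‖F j‖ ≤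
      c * (beta (1 - δ / 2) (δ - 1) * (n : ℝ) ^ (-(δ - 1))) := fun N => by
    refine (Finset.sum_le_sum fun j _ => hbound j).trans ?_
    rw [← Finset.mul_sum]
    exact mul_le_mul_of_nonneg_left (sum_rpow_mul_rpow_le_beta hδ1 hδ2 hn N) hc0
  rw [← hsum.tsum_eq]
  calc ‖∑' j, F j‖ ≤ ∑' j, ‖F j‖ := norm_tsum_le_tsum_norm
        (summable_of_sum_range_le (fun _ => norm_nonneg _) hpartial)
    _ ≤ c * (beta (1 - δ / 2) (δ - 1) * (n : ℝ) ^ (-(δ - 1))) :=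
        Real.tsum_le_of_sum_range_le (fun _ => norm_nonneg _) hpartial
    _ = _ := by rw [hc]; ring

lemma norm_codifference_comp_pow_div_le (hp : p ≤ 2) {γ lam0 δ : ℝ} (hγ : 1 < γ)
    (hlam0 : 0 < lam0) (hδ1 : 1 < δ) (hδ2 : δ < 2) (hδγ : δ ≤ γ) {T : EllP p →L[ℝ] EllP p}
    (hT : IsWeightedBackwardShift p γ T) (hμ : IsCompoundPoisson p (lambdaSeq p γ lam0) μ)
    {n : ℕ} (hn : 1 ≤ n) {x y : StrongDual ℝ (EllP p)} (hx : x ≠ 0) (hy : y ≠ 0) :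
    ‖codifference μ x (y ∘L (T ^ n))‖ / (‖x‖ ^ (p / 2) * ‖y‖ ^ (p / 2)) ≤
      2 ^ (4 - p) * lam0 ^ p * beta (1 - δ / 2) (δ - 1) * (n : ℝ) ^ (-(δ - 1)) := by
  have hx' := norm_pos_iff.mpr hx
  have hy' := norm_pos_iff.mpr hy
  have hb : 0 < beta (1 - δ / 2) (δ - 1) := beta_pos (by linarith) (by linarith)
  rw [div_le_iff₀ (by positivity)]
  refine (norm_codifference_comp_pow_le hp hγ hlam0 hδ1 hδ2 hδγ hT hμ hn x y).trans ?_
  -- The bound obtained has the sharper constant `2 ^ (2 - p)`, which is relaxed here to `2 ^ (4 -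
  -- p)`.
  gcongr
  · norm_num
  · norm_num

end Codifference

end

theorem mainTheorem4 (p : ℝ) [Fact (1 ≤ p)] (hp : p < 2) (γ : ℝ) (hγ : 1 < γ)
    (lam0 : ℝ) (hlam0 : 0 < lam0)
    [MeasurableSpace (EllP p)] [BorelSpace (EllP p)] :
    -- the operator and the measure are well defined
    (∃! T : EllP p →L[ℝ] EllP p, IsWeightedBackwardShift p γ T) ∧
    (∃! μ : Measure (EllP p), IsCompoundPoisson p (lambdaSeq p γ lam0) μ) ∧
    ∀ (T : EllP p →L[ℝ] EllP p) (μ : Measure (EllP p)),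
      IsWeightedBackwardShift p γ T →
      IsCompoundPoisson p (lambdaSeq p γ lam0) μ →
      -- the logarithms in the codifference are well defined
      (∃! ψ : StrongDual ℝ (EllP p) → ℂ, IsDistinguishedLog μ ψ) ∧
      -- invariance and mixing
      MeasurePreserving T μ μ ∧
      IsStronglyMixing T μ ∧
      -- rates; the n-th power of the adjoint of T maps y to y ∘L (T ^ n)
      (γ < 2 → ∀ n : ℕ, 1 ≤ n → ∀ x y : StrongDual ℝ (EllP p), x ≠ 0 → y ≠ 0 →
        ‖codifference μ x (y ∘L (T ^ n))‖ / (‖x‖ ^ (p / 2) * ‖y‖ ^ (p / 2)) ≤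
          2 ^ (4 - p) * lam0 ^ p * ProbabilityTheory.beta (1 - γ / 2) (γ - 1) *
            (n : ℝ) ^ (-(γ - 1))) ∧
      (2 ≤ γ → ∀ ε : ℝ, 0 < ε → ε < 1 →
        ∀ n : ℕ, 1 ≤ n → ∀ x y : StrongDual ℝ (EllP p), x ≠ 0 → y ≠ 0 →
        ‖codifference μ x (y ∘L (T ^ n))‖ / (‖x‖ ^ (p / 2) * ‖y‖ ^ (p / 2)) ≤
          2 ^ (4 - p) * lam0 ^ p * ProbabilityTheory.beta (ε / 2) (1 - ε) *
            (n : ℝ) ^ (-(1 - ε))) := by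
  
  have hpos := lambdaSeq_pos (p := p) (γ := γ) hlam0
  have hl := summable_lambdaSeq_rpow (p := p) hγ hlam0
  refine ⟨existsUnique_isWeightedBackwardShift (by linarith), ?_, fun T μ hT hμ => ?_⟩
  · obtain ⟨μ, hμ⟩ := exists_isCompoundPoisson hp.le hl hpos
    exact ⟨μ, hμ, fun ν hν => IsCompoundPoisson.unique hν hμ⟩
  have hψ := isDistinguishedLog_poissonExponent hl hpos hμ
  have hinv : MeasurePreserving T μ μ :=
    measurePreserving_of_shift hl hpos hμ hT.map_zero hT.map_lambdaSeq_succ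
  refine ⟨⟨_, hψ, fun φ hφ => hφ.unique hψ⟩, hinv,
    isStronglyMixing_of_shift hl hpos hμ hinv fun n k hk => hT.pow_map_basisVec_of_lt hk,
    fun hγ2 n hn x y hx hy =>
      norm_codifference_comp_pow_div_le hp.le hγ hlam0 hγ hγ2 le_rfl hT hμ hn hx hy,
    fun hγ2 ε hε0 hε1 n hn x y hx hy => ?_⟩
  have h := norm_codifference_comp_pow_div_le hp.le hγ hlam0 (δ := 2 - ε) (by linarith)
    (by linarith) (by linarith) hT hμ hn hx hy
  rwa [show 1 - (2 - ε) / 2 = ε / 2 by ring, show 2 - ε - 1 = 1 - ε by ring] at h
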